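/- Let $X$ be an arbitrary Banach space over $\mathbb K=\mathbb R$ or $\mathbb C$, and let $\mathcal L(X)$ be the space of bounded linear operators on $X$. A relation on $X$ is a linear subspace $A\subset X\times X$; for $\lambda\in\mathbb K$ put $\lambda-A=\{(x,\lambda x-y):(x,y)\in A\}$. The resolvent set $\rho(A)$ is the set of $\lambda\in\mathbb K$ such that $\lambda-A$ is closed in $X\times X$, has range $\{z: \exists x,\ (x,z)\in\lambda-A\}$ equal to $X$, and has kernel $\{x:(x,0)\in\lambda-A\}$ equal to $\{0\}$; for $\lambda\in\rho(A)$ the resolvent $R(\lambda,A)\in\mathcal L(X)$ is the operator with $(\lambda-A)^{-1}=\{(z,x):(x,z)\in\lambda-A\}=\{(z,R(\lambda,A)z):z\in X\}$. The relation $A$ is $m$-dissipative if $\|\lambda x\|\le\|\lambda x-y\|$ for all $(x,y)\in A$ and all real $\lambda>0$, and $\lambda-A$ has range $X$ for some real $\lambda>0$. For a function $S:[0,\infty)\to\mathcal L(X)$ and a relation $A$ on $X$ consider the conditions (a) $S(0)=0$; (b) $\|S(t)-S(s)\|\le|t-s|$ for all $s,t\ge0$; (c) for every real $\lambda>0$,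 $\lambda\in\rho(A)$ and $R(\lambda,A)=\lambda\int_0^\infty e^{-\lambda t}S(t)\,dt$ (an absolutely convergent integral in $\mathcal L(X)$); (d) $S(t)S(s)=\int_t^{t+s}S(r)\,dr-\int_0^sS(r)\,dr$ for all $s,t\ge0$. 1. Let $A$ be an $m$-dissipative relation on $X$. Then there exists a unique function $S:[0,\infty)\to\mathcal L(X)$ such that (a), (b) and (c) hold (the integrated semigroup generated by $A$). Moreover, this $S$ satisfies (d). 2. Conversely, let $S:[0,\infty)\to\mathcal L(X)$ be a function such that (a), (b) and (d) hold. Then there exists a unique $m$-dissipative relation $A$ on $X$ such that (c) holds. -/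

import Mathlib

open MeasureTheory Set
open scoped NNReal

/-- A (linear) relation on `X`: a linear subspace of `X × X`. -/
abbrev LinRel (𝕜 X : Type*) [RCLike 𝕜] [NormedAddCommGroup X] [NormedSpace 𝕜 X] :=
  Submodule 𝕜 (X × X)

namespace LinRel

section Basic

variable {𝕜 X : Type*} [RCLike 𝕜] [NormedAddCommGroup X] [NormedSpace 𝕜 X]

/-- The kernel `{x | (x, 0) ∈ A}`. -/
def ker (A : LinRel 𝕜 X) : Set X := {x | (x, (0 : X)) ∈ A}

/-- The range `{y | ∃ x, (x, y) ∈ A}`. -/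
def ran (A : LinRel 𝕜 X) : Set X := {y | ∃ x, (x, y) ∈ A}

/-- The inverse relation `{(y, x) | (x, y) ∈ A}`. -/
def inv (A : LinRel 𝕜 X) : LinRel 𝕜 X :=
  A.map ((LinearMap.snd 𝕜 X X).prod (LinearMap.fst 𝕜 X X))

/-- The relation `c - A = {(x, c x - y) | (x, y) ∈ A}`. -/
def shift (c : 𝕜) (A : LinRel 𝕜 X) : LinRel 𝕜 X :=
  A.map ((LinearMap.fst 𝕜 X X).prod (c • LinearMap.fst 𝕜 X X - LinearMap.snd 𝕜 X X))

/-- A relation is invertible if it is closed, has trivial kernel, and is surjective. -/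
def Invertible (A : LinRel 𝕜 X) : Prop :=
  IsClosed (A : Set (X × X)) ∧ ker A = {0} ∧ ran A = univ

/-- The resolvent set `ρ(A)`. -/
def resolventSet (A : LinRel 𝕜 X) : Set 𝕜 := {c | Invertible (shift c A)}

open Classical in
/-- The resolvent `R(c, A)`: the bounded operator whose graph is `(c - A)⁻¹`.
It exists and is unique for `c ∈ ρ(A)`, see `existsUnique_inv_shift_eq_graph`;
if there is no such operator, the value is `0`. -/
noncomputable def resolvent (A : LinRel 𝕜 X) (c : 𝕜) : X →L[𝕜] X :=
  if h : ∃ Q : X →L[𝕜] X, inv (shift c A) = (Q : X →ₗ[𝕜] X).graph then h.choose else 0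

/-- `A` is dissipative: `‖c x‖ ≤ ‖c x - y‖` for all `(x, y) ∈ A` and all real `c > 0`. -/
def Dissipative (A : LinRel 𝕜 X) : Prop :=
  ∀ x y : X, (x, y) ∈ A → ∀ c : ℝ, 0 < c → ‖(c : 𝕜) • x‖ ≤ ‖(c : 𝕜) • x - y‖

/-- `A` is m-dissipative: it is dissipative and `c - A` is surjective for some real `c > 0`. -/
def MDissipative (A : LinRel 𝕜 X) : Prop :=
  Dissipative A ∧ ∃ c : ℝ, 0 < c ∧ ran (shift (c : 𝕜) A) = univ

theorem mem_inv {A : LinRel 𝕜 X} {x y : X} : (y, x) ∈ inv A ↔ (x, y) ∈ A := by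
  simp only [inv, Submodule.mem_map]
  constructor
  · rintro ⟨⟨a, b⟩, h, e⟩
    obtain rfl : b = y := congrArg Prod.fst e
    obtain rfl : a = x := congrArg Prod.snd e
    exact h
  · intro h
    exact ⟨(x, y), h, rfl⟩

theorem mem_shift {A : LinRel 𝕜 X} {c : 𝕜} {x z : X} :
    (x, z) ∈ shift c A ↔ (x, c • x - z) ∈ A := by
  simp only [shift, Submodule.mem_map]
  constructor
  · rintro ⟨⟨a, b⟩, h, e⟩
    obtain rfl : a = x := congrArg Prod.fst e
    obtain rfl : c • a - b = z := congrArg Prod.snd e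
    simpa using h
  · intro h
    exact ⟨(x, c • x - z), h, Prod.ext rfl (sub_sub_cancel (c • x) z)⟩

theorem existsUnique_inv_shift_eq_graph [CompleteSpace X] {A : LinRel 𝕜 X} {c : 𝕜}
    (hc : c ∈ resolventSet A) :
    ∃! Q : X →L[𝕜] X, inv (shift c A) = (Q : X →ₗ[𝕜] X).graph := by
  obtain ⟨hcl, hker, hran⟩ := hc
  have hex : ∀ y, ∃ x, (x, y) ∈ shift c A := fun y => by
    have : y ∈ ran (shift c A) := by rw [hran]; trivial
    exact this
  have huniq : ∀ x x' y, (x, y) ∈ shift c A → (x', y) ∈ shift c A → x = x' := by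
    intro x x' y h h'
    have h0 : x - x' ∈ ker (shift c A) := by
      have := (shift c A).sub_mem h h'
      simpa [ker] using this
    rw [hker] at h0
    exact sub_eq_zero.mp h0
  choose f hf using hex
  let L : X →ₗ[𝕜] X :=
    { toFun := f
      map_add' := fun a b => huniq _ _ _ (hf (a + b)) ((shift c A).add_mem (hf a) (hf b))
      map_smul' := fun k a => huniq _ _ _ (hf (k • a)) ((shift c A).smul_mem k (hf a)) }
  have hgr : ∀ y x, (y, x) ∈ L.graph ↔ (x, y) ∈ shift c A := by
    intro y x
    rw [LinearMap.mem_graph_iff]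
    constructor
    · intro h
      have h2 : x = f y := h
      rw [h2]; exact hf y
    · intro h
      exact huniq _ _ _ h (hf y)
  have hLcl : IsClosed (L.graph : Set (X × X)) := by
    have : (L.graph : Set (X × X)) = Prod.swap ⁻¹' (shift c A : Set (X × X)) := by
      ext ⟨y, x⟩
      exact hgr y x
    rw [this]
    exact hcl.preimage continuous_swap
  refine ⟨ContinuousLinearMap.ofIsClosedGraph hLcl, ?_, ?_⟩
  · ext ⟨y, x⟩
    rw [mem_inv]
    exact (hgr y x).symm
  · intro Q hQ
    ext y
    have h : (y, Q y) ∈ inv (shift c A) := by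
      rw [hQ, LinearMap.mem_graph_iff]; rfl
    exact huniq _ _ _ (mem_inv.mp h) (hf y)

theorem inv_shift_eq_graph_resolvent [CompleteSpace X] {A : LinRel 𝕜 X} {c : 𝕜}
    (hc : c ∈ resolventSet A) :
    inv (shift c A) = (resolvent A c : X →ₗ[𝕜] X).graph := by
  have h := (existsUnique_inv_shift_eq_graph hc).exists
  rw [resolvent, dif_pos h]
  exact h.choose_spec

end Basic

section Integrated

variable {𝕜 X : Type*} [RCLike 𝕜] [NormedAddCommGroup X] [NormedSpace 𝕜 X]
  [NormedSpace ℝ X] [IsScalarTower ℝ 𝕜 X]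

/-- For all `c > 0`: `c ∈ ρ(A)` and `R(c, A) = c ∫₀^∞ e^{-ct} S(t) dt`, the integral being an
absolutely convergent Bochner integral in the space of bounded operators. -/
def ResolventIsLaplace (A : LinRel 𝕜 X) (S : ℝ≥0 → X →L[𝕜] X) : Prop :=
  ∀ c : ℝ, 0 < c →
    (c : 𝕜) ∈ resolventSet A ∧
    IntegrableOn (fun t : ℝ => Real.exp (-c * t) • S t.toNNReal) (Ioi 0) ∧
    resolvent A (c : 𝕜) = c • ∫ t in Ioi (0 : ℝ), Real.exp (-c * t) • S t.toNNReal

/-- `S(t) S(s) = ∫_t^{t+s} S(r) dr - ∫_0^s S(r) dr` for all `t, s ≥ 0`. -/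
def IntegratedFunctionalEquation (S : ℝ≥0 → X →L[𝕜] X) : Prop :=
  ∀ t s : ℝ≥0, (S t).comp (S s) =
    (∫ r in (t : ℝ)..((t : ℝ) + (s : ℝ)), S r.toNNReal) - ∫ r in (0 : ℝ)..(s : ℝ), S r.toNNReal

/-- `S(0) = 0`, `S` is 1-Lipschitz in operator norm, and `R(c, A) = c ∫₀^∞ e^{-ct} S(t) dt` for
all `c > 0`: `S` is the integrated semigroup generated by `A`. -/
def GeneratesIntegratedSemigroup (A : LinRel 𝕜 X) (S : ℝ≥0 → X →L[𝕜] X) : Prop :=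
  S 0 = 0 ∧ (∀ t s : ℝ≥0, ‖S t - S s‖ ≤ |(t : ℝ) - (s : ℝ)|) ∧ ResolventIsLaplace A S

end Integrated

end LinRel

/-! Both directions pass through a pseudo-resolvent `R(c)`, `c > 0`, with `‖c R(c)‖ ≤ 1`. Such
families correspond to m-dissipative relations: dissipativity gives the bound, a Neumann series
carries surjectivity of `c - A` from one `c` to all `c > 0`, and conversely `{(x, y) | x = R(1) (x -
y)}` is a relation with resolvent `R`. Relations are needed because `R(c)` may have a nontrivial
kernel. What remains is to match contractive pseudo-resolvents with integrated semigroups, which is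
done in a real Banach algebra.

From `S` to `R`: Laplace transforms in `s` and then in `t` turn the functional equation into the
resolvent identity (`resolvent_identity_of_functionalEquation`), and the Lipschitz condition gives
the bound.

From `R` to `S` (`exists_integratedSemigroup`): the Yosida approximations `B_μ = μ² R(μ) - μ`
commute and generate contraction semigroups. Without a dense domain `exp (t B_μ)` need not converge,
but `exp (t B_μ) R(1)` converges in norm, and `∫₀ᵗ exp (r B_μ) dr` is expressed through it up to
`O(1/μ)`. The limit inherits the Lipschitz bound and the functional equation; its transform is right
because `c` times the approximate transform is within `4/μ` of `R(c)`.

Uniqueness of `S` is injectivity of the Laplace transform, a consequence of Weierstrass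
approximation. Uniqueness of `A` holds because `R(1)` determines `1 - A`. -/

/-! ### Laplace transforms of functions of linear growth -/

section Laplace

open Filter Topology

variable {E : Type*} [NormedAddCommGroup E] [NormedSpace ℝ E]

theorem integrableOn_exp_neg_mul_mul_id {c : ℝ} (hc : 0 < c) :
    IntegrableOn (fun t : ℝ => Real.exp (-c * t) * t) (Ioi 0) := by
  have h := integrableOn_rpow_mul_exp_neg_mul_rpow (p := 1) (s := 1) (b := c)
    (by norm_num) one_pos hc
  refine h.congr_fun (fun t _ => ?_) measurableSet_Ioi
  simp [mul_comm]

theorem integral_exp_neg_mul_mul_id {c : ℝ} (hc : 0 < c) :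
    ∫ t in Ioi (0 : ℝ), Real.exp (-c * t) * t = 1 / c ^ 2 := by
  have h := Real.integral_rpow_mul_exp_neg_mul_Ioi (a := 2) (r := c) two_pos hc
  rw [Real.Gamma_two, mul_one] at h
  rw [← one_div_pow, ← Real.rpow_two, ← h]
  refine setIntegral_congr_fun measurableSet_Ioi (fun t _ => ?_)
  norm_num [mul_comm]

theorem integral_exp_neg_mul_Ioi_zero {c : ℝ} (hc : 0 < c) :
    ∫ t in Ioi (0 : ℝ), Real.exp (-c * t) = 1 / c := by
  rw [integral_exp_mul_Ioi (neg_neg_of_pos hc)]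
  simp [neg_div_neg_eq]

theorem integrableOn_exp_neg_mul_Ioi_zero {c : ℝ} (hc : 0 < c) :
    IntegrableOn (fun t : ℝ => Real.exp (-c * t)) (Ioi 0) :=
  integrableOn_exp_mul_Ioi (neg_neg_of_pos hc) 0

theorem integrableOn_exp_smul {f : ℝ → E} (hf : Continuous f) {K : ℝ}
    (hb : ∀ t, 0 < t → ‖f t‖ ≤ K * t) {c : ℝ} (hc : 0 < c) :
    IntegrableOn (fun t : ℝ => Real.exp (-c * t) • f t) (Ioi 0) := by
  refine Integrable.mono' ((integrableOn_exp_neg_mul_mul_id hc).const_mul K)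
    (Continuous.aestronglyMeasurable (by fun_prop)) ?_
  refine (ae_restrict_iff' measurableSet_Ioi).2 (.of_forall fun t ht => ?_)
  rw [norm_smul, Real.norm_of_nonneg (Real.exp_pos _).le]
  nlinarith [hb t ht, Real.exp_pos (-c * t)]

theorem norm_integral_exp_smul_le {f : ℝ → E} {K : ℝ}
    (hb : ∀ t, 0 < t → ‖f t‖ ≤ K * t) {c : ℝ} (hc : 0 < c) :
    ‖∫ t in Ioi (0 : ℝ), Real.exp (-c * t) • f t‖ ≤ K / c ^ 2 := by
  have h := norm_integral_le_of_norm_le ((integrableOn_exp_neg_mul_mul_id hc).const_mul K)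
    (f := fun t : ℝ => Real.exp (-c * t) • f t) ?_
  · rwa [integral_const_mul, integral_exp_neg_mul_mul_id hc, mul_one_div] at h
  refine (ae_restrict_iff' measurableSet_Ioi).2 (.of_forall fun t ht => ?_)
  rw [norm_smul, Real.norm_of_nonneg (Real.exp_pos _).le]
  nlinarith [hb t ht, Real.exp_pos (-c * t)]

theorem tendsto_exp_smul_atTop {f : ℝ → E} {K : ℝ}
    (hb : ∀ t, 0 < t → ‖f t‖ ≤ K * t) {c : ℝ} (hc : 0 < c) :
    Tendsto (fun t : ℝ => Real.exp (-c * t) • f t) atTop (𝓝 0) := by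
  have h : Tendsto (fun t : ℝ => K * (t ^ (1 : ℝ) * Real.exp (-c * t))) atTop (𝓝 (K * 0)) :=
    (tendsto_rpow_mul_exp_neg_mul_atTop_nhds_zero 1 c hc).const_mul K
  rw [mul_zero] at h
  refine squeeze_zero_norm' ?_ h
  filter_upwards [eventually_gt_atTop 0] with t ht
  rw [norm_smul, Real.norm_of_nonneg (Real.exp_pos _).le, Real.rpow_one]
  nlinarith [hb t ht, Real.exp_pos (-c * t)]

/-- If `g' = a g + h` with `g`, `h` of at most linear growth, then the Laplace transforms satisfy
`(c - a) ĝ(c) = g(0) + ĥ(c)`. -/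
theorem laplace_of_hasDerivAt [CompleteSpace E] {g h : ℝ → E} {a K c : ℝ} (hc : 0 < c)
    (hg : ∀ t, 0 ≤ t → HasDerivAt g (a • g t + h t) t)
    (hgb : ∀ t, 0 < t → ‖g t‖ ≤ K * t)
    (hgi : IntegrableOn (fun t : ℝ => Real.exp (-c * t) • g t) (Ioi 0))
    (hhi : IntegrableOn (fun t : ℝ => Real.exp (-c * t) • h t) (Ioi 0)) :
    (c - a) • ∫ t in Ioi (0 : ℝ), Real.exp (-c * t) • g t =
      g 0 + ∫ t in Ioi (0 : ℝ), Real.exp (-c * t) • h t := by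
  have hd : ∀ t ∈ Ici (0 : ℝ), HasDerivAt (fun t : ℝ => Real.exp (-c * t) • g t)
      (Real.exp (-c * t) • h t - (c - a) • Real.exp (-c * t) • g t) t := by
    intro t ht
    have h1 : HasDerivAt (fun t : ℝ => Real.exp (-c * t)) (Real.exp (-c * t) * (-c * 1)) t :=
      ((hasDerivAt_id t).const_mul (-c)).exp
    refine (h1.smul (hg t ht)).congr_deriv ?_
    module
  have hgi' : IntegrableOn (fun t : ℝ => (c - a) • Real.exp (-c * t) • g t) (Ioi 0) :=
    hgi.smul (c - a)
  have h2 := integral_Ioi_of_hasDerivAt_of_tendsto' hd (hhi.sub hgi')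
    (tendsto_exp_smul_atTop hgb hc)
  rw [integral_sub hhi hgi', integral_smul] at h2
  simp only [mul_zero, Real.exp_zero, one_smul, zero_sub] at h2
  rw [eq_comm, ← sub_eq_zero]
  have h3 := sub_eq_zero.2 h2
  rw [← h3]
  abel

/-- Under `u = exp (-t)` the transforms at `1, 2, 3, ...` are the moments of `f (-log u)` on `(0,
1]`. Approximating `h u = u * f (-log u)` uniformly by polynomials gives `∫ (exp (-t) * f t) ^ 2 =
0`. The extra factor `u` makes `h` continuous at `0` despite the growth of `f`. -/
theorem eq_zero_of_laplace_eq_zero_real {f : ℝ → ℝ} (hf : Continuous f) {K : ℝ}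
    (hb : ∀ t, 0 < t → |f t| ≤ K * t)
    (h0 : ∀ c : ℝ, 0 < c → ∫ t in Ioi (0 : ℝ), Real.exp (-c * t) * f t = 0) :
    ∀ t, 0 < t → f t = 0 := by
  have hK : 0 ≤ K := by simpa using (abs_nonneg _).trans (hb 1 one_pos)
  have hint : ∀ c : ℝ, 0 < c → IntegrableOn (fun t : ℝ => Real.exp (-c * t) * f t) (Ioi 0) :=
    fun c hc => integrableOn_exp_smul hf hb hc
  set h : ℝ → ℝ := fun u => u * f (-Real.log u) with hh
  have hcont : ContinuousOn h (Icc 0 1) := by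
    intro u hu
    rcases hu.1.eq_or_lt with rfl | hu0
    · have : Tendsto (fun u : ℝ => K * |u * Real.log u|) (𝓝 0) (𝓝 (K * |(0 : ℝ) * Real.log 0|)) :=
        ((Real.continuous_mul_log.abs.const_mul K).tendsto 0)
      have h1 : Tendsto (fun u : ℝ => K * |u * Real.log u|) (𝓝[Icc 0 1] 0) (𝓝 0) := by
        simpa using this.mono_left nhdsWithin_le_nhds
      have : h 0 = 0 := by simp [hh]
      rw [ContinuousWithinAt, this]
      refine squeeze_zero_norm' ?_ h1
      filter_upwards [self_mem_nhdsWithin] with u hu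
      rcases hu.1.eq_or_lt with rfl | hu0
      · simp [hh]
      rcases hu.2.eq_or_lt with rfl | hu1
      · have hf0 : |f 0| ≤ 0 := by
          have hl : Tendsto (fun t => K * t) (𝓝[>] 0) (𝓝 (K * 0)) :=
            ((continuous_const_mul K).tendsto 0).mono_left nhdsWithin_le_nhds
          rw [mul_zero] at hl
          refine le_of_tendsto_of_tendsto ((hf.abs.tendsto 0).mono_left nhdsWithin_le_nhds) hl ?_
          filter_upwards [self_mem_nhdsWithin] with t ht using hb t ht
        simpa [hh] using hf0
      have hl := Real.log_neg hu0 hu1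
      have := hb (-Real.log u) (by linarith)
      rw [Real.norm_eq_abs, hh, abs_mul, abs_mul, abs_of_neg hl]
      nlinarith [abs_nonneg u]
    · exact ((continuousAt_id.mul (hf.continuousAt.comp
        (Real.continuousAt_log hu0.ne').neg))).continuousWithinAt
  have hpoly : ∀ p : Polynomial ℝ,
      IntegrableOn (fun t : ℝ => Real.exp (-1 * t) * f t * p.eval (Real.exp (-t))) (Ioi 0) ∧
      ∫ t in Ioi (0 : ℝ), Real.exp (-1 * t) * f t * p.eval (Real.exp (-t)) = 0 := by
    intro p
    induction p using Polynomial.induction_on' with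
    | add p q hp hq =>
      simp only [Polynomial.eval_add, mul_add]
      exact ⟨hp.1.add hq.1, by rw [integral_add hp.1 hq.1, hp.2, hq.2, add_zero]⟩
    | monomial n a =>
      have he : (fun t : ℝ => Real.exp (-1 * t) * f t *
          (Polynomial.monomial n a).eval (Real.exp (-t))) =
          fun t => a * (Real.exp (-(n + 1 : ℝ) * t) * f t) := by
        ext t
        rw [Polynomial.eval_monomial, ← Real.exp_nat_mul,
          show -(n + 1 : ℝ) * t = -1 * t + n * -t by ring, Real.exp_add]
        ring
      have hn : (0 : ℝ) < n + 1 := by positivity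
      rw [he]
      exact ⟨(hint _ hn).const_mul a, by rw [integral_const_mul, h0 _ hn, mul_zero]⟩
  have hexp : ∀ t : ℝ, h (Real.exp (-t)) = Real.exp (-t) * f t := by
    intro t; simp [hh]
  have hsq : ∀ t, Real.exp (-1 * t) * f t * h (Real.exp (-t)) = (Real.exp (-t) * f t) ^ 2 := by
    intro t; rw [hexp, neg_one_mul]; ring
  have hbdd : ∀ t ∈ Ioi (0 : ℝ), ‖(Real.exp (-t) * f t)‖ ≤ K := by
    intro t ht
    rw [norm_mul, Real.norm_of_nonneg (Real.exp_pos _).le, Real.norm_eq_abs]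
    have h1 : Real.exp (-t) * t ≤ 1 := by
      rw [Real.exp_neg, inv_mul_le_iff₀ (Real.exp_pos _), mul_one]
      linarith [Real.add_one_le_exp t]
    calc _ ≤ Real.exp (-t) * (K * t) := by gcongr; exact hb t ht
      _ = K * (Real.exp (-t) * t) := by ring
      _ ≤ K * 1 := by gcongr
      _ = K := mul_one K
  have hi2 : IntegrableOn (fun t : ℝ => (Real.exp (-t) * f t) ^ 2) (Ioi 0) := by
    have h1 := hint 1 one_pos
    simp only [neg_one_mul] at h1
    refine Integrable.mono' (h1.norm.const_mul K)
      (Continuous.aestronglyMeasurable (by fun_prop)) ?_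
    refine (ae_restrict_iff' measurableSet_Ioi).2 (.of_forall fun t ht => ?_)
    rw [norm_pow, sq]
    exact mul_le_mul_of_nonneg_right (hbdd t ht) (norm_nonneg _)
  have hz : ∫ t in Ioi (0 : ℝ), (Real.exp (-t) * f t) ^ 2 = 0 := by
    refine le_antisymm ?_ (integral_nonneg fun t => sq_nonneg _)
    set M := ∫ t in Ioi (0 : ℝ), ‖Real.exp (-1 * t) * f t‖
    have hM : 0 ≤ M := integral_nonneg fun t => norm_nonneg _
    refine le_of_forall_pos_le_add fun ε hε => ?_
    obtain ⟨p, hp⟩ := exists_polynomial_near_of_continuousOn 0 1 h hcont (ε / (M + 1))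
      (by positivity)
    have e1 : ∫ t in Ioi (0 : ℝ), (Real.exp (-t) * f t) ^ 2 =
        ∫ t in Ioi (0 : ℝ), ((Real.exp (-t) * f t) ^ 2 -
          Real.exp (-1 * t) * f t * p.eval (Real.exp (-t))) := by
      rw [integral_sub hi2 (hpoly p).1, (hpoly p).2, sub_zero]
    rw [e1, zero_add]
    refine (le_abs_self _).trans ?_
    rw [← Real.norm_eq_abs]
    refine (norm_integral_le_of_norm_le ((hint 1 one_pos).norm.const_mul (ε / (M + 1)))
      ((ae_restrict_iff' measurableSet_Ioi).2 (.of_forall fun t ht => ?_))).trans ?_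
    · rw [← hsq, ← mul_sub, norm_mul, mul_comm]
      gcongr
      rw [norm_sub_rev]
      exact (hp _ ⟨(Real.exp_pos _).le, Real.exp_le_one_iff.2 (by simpa using ht.le)⟩).le
    · rw [integral_const_mul, div_mul_eq_mul_div, div_le_iff₀ (by positivity)]
      nlinarith
  have hae := (setIntegral_eq_zero_iff_of_nonneg_ae (.of_forall fun t => sq_nonneg _) hi2).1 hz
  intro t ht
  have heq : EqOn (fun t : ℝ => (Real.exp (-t) * f t) ^ 2) 0 (Ioi 0) :=
    Measure.eqOn_open_of_ae_eq hae isOpen_Ioi (Continuous.continuousOn (by fun_prop))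
      continuousOn_const
  simpa [Real.exp_ne_zero] using heq ht

theorem eq_zero_of_laplace_eq_zero [CompleteSpace E] {f : ℝ → E} (hf : Continuous f) {K : ℝ}
    (hb : ∀ t, 0 < t → ‖f t‖ ≤ K * t)
    (h0 : ∀ c : ℝ, 0 < c → ∫ t in Ioi (0 : ℝ), Real.exp (-c * t) • f t = 0) :
    ∀ t, 0 < t → f t = 0 := by
  intro t ht
  refine (SeparatingDual.eq_zero_iff_forall_dual_eq_zero (R := ℝ) (f t)).2 fun φ => ?_
  refine eq_zero_of_laplace_eq_zero_real (f := fun t => φ (f t)) (by fun_prop) (K := ‖φ‖ * K)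
    (fun t ht => ?_) (fun c hc => ?_) t ht
  · rw [mul_assoc]
    exact (φ.le_opNorm _).trans (mul_le_mul_of_nonneg_left (hb t ht) (norm_nonneg _))
  · have := φ.integral_comp_comm (integrableOn_exp_smul hf hb hc)
    rw [h0 c hc, map_zero] at this
    simpa using this

end Laplace

/-! ### Uniqueness of `S`, and the pseudo-resolvent defined by the functional equation -/

section FunctionalEquation

open Filter Topology

variable {E : Type*} [NormedAddCommGroup E]

theorem continuous_comp_toNNReal {S : ℝ≥0 → E}
    (hS : ∀ t s : ℝ≥0, ‖S t - S s‖ ≤ |(t : ℝ) - (s : ℝ)|) :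
    Continuous fun t : ℝ => S t.toNNReal := by
  have : LipschitzWith 1 S := LipschitzWith.of_dist_le_mul fun t s => by
    simpa [dist_eq_norm, NNReal.dist_eq] using hS t s
  exact this.continuous.comp continuous_real_toNNReal

theorem norm_comp_toNNReal_le {S : ℝ≥0 → E} (h0 : S 0 = 0)
    (hS : ∀ t s : ℝ≥0, ‖S t - S s‖ ≤ |(t : ℝ) - (s : ℝ)|) (t : ℝ) (ht : 0 < t) :
    ‖S t.toNNReal‖ ≤ 1 * t := by
  simpa [h0, ht.le, abs_of_pos ht] using hS t.toNNReal 0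

/-- Uniqueness of the Laplace transform for Lipschitz functions. -/
theorem eq_of_laplace_eq [NormedSpace ℝ E] [CompleteSpace E] {S T : ℝ≥0 → E}
    (hS0 : S 0 = 0) (hT0 : T 0 = 0)
    (hS : ∀ t s : ℝ≥0, ‖S t - S s‖ ≤ |(t : ℝ) - (s : ℝ)|)
    (hT : ∀ t s : ℝ≥0, ‖T t - T s‖ ≤ |(t : ℝ) - (s : ℝ)|)
    (h : ∀ c : ℝ, 0 < c → ∫ t in Ioi (0 : ℝ), Real.exp (-c * t) • S t.toNNReal =
      ∫ t in Ioi (0 : ℝ), Real.exp (-c * t) • T t.toNNReal) : S = T := by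
  have hSc := continuous_comp_toNNReal hS
  have hTc := continuous_comp_toNNReal hT
  have hSb := norm_comp_toNNReal_le hS0 hS
  have hTb := norm_comp_toNNReal_le hT0 hT
  have key := eq_zero_of_laplace_eq_zero
    (f := fun t : ℝ => S t.toNNReal - T t.toNNReal) (hSc.sub hTc) (K := 2)
    (fun t ht => (norm_sub_le _ _).trans (by linarith [hSb t ht, hTb t ht])) (fun c hc => ?_)
  · ext t
    rcases eq_or_ne t 0 with rfl | ht
    · rw [hS0, hT0]
    · simpa [sub_eq_zero] using key t (by positivity)
  · simp only [smul_sub]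
    rw [integral_sub (integrableOn_exp_smul hSc hSb hc) (integrableOn_exp_smul hTc hTb hc),
      h c hc, sub_self]

theorem laplace_comp_add [NormedSpace ℝ E] [CompleteSpace E] {f : ℝ → E} {c t : ℝ}
    (hf : Continuous f)
    (hi : IntegrableOn (fun t : ℝ => Real.exp (-c * t) • f t) (Ioi 0)) :
    ∫ s in Ioi (0 : ℝ), Real.exp (-c * s) • f (t + s) =
      Real.exp (c * t) • ((∫ s in Ioi (0 : ℝ), Real.exp (-c * s) • f s) -
        ∫ s in (0 : ℝ)..t, Real.exp (-c * s) • f s) := by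
  have h1 := (measurePreserving_add_left volume t).setIntegral_preimage_emb
    (measurableEmbedding_addLeft t) (fun s : ℝ => Real.exp (-c * s) • f s) (Ioi t)
  have hc : Continuous fun s : ℝ => Real.exp (-c * s) • f s := by fun_prop
  have hit : IntegrableOn (fun s : ℝ => Real.exp (-c * s) • f s) (Ioi t) := by
    refine ((hc.integrableOn_Ioc (a := t) (b := 0)).union hi).mono_set ?_
    intro s hs
    by_cases h : s ≤ 0
    · exact Or.inl ⟨hs, h⟩
    · exact Or.inr (not_le.1 h)
  rw [preimage_const_add_Ioi, sub_self] at h1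
  have h2 := intervalIntegral.integral_interval_add_Ioi hi hit
  rw [← h2, add_sub_cancel_left, ← h1, ← integral_smul]
  refine setIntegral_congr_fun measurableSet_Ioi fun s _ => ?_
  rw [smul_smul, ← Real.exp_add]
  congr 2
  ring

variable {𝔸 : Type*} [NormedRing 𝔸] [NormedAlgebra ℝ 𝔸]

theorem norm_smul_laplace_le {S : ℝ≥0 → 𝔸} (h0 : S 0 = 0)
    (hS : ∀ t s : ℝ≥0, ‖S t - S s‖ ≤ |(t : ℝ) - (s : ℝ)|) {c : ℝ} (hc : 0 < c) :
    ‖c • c • ∫ t in Ioi (0 : ℝ), Real.exp (-c * t) • S t.toNNReal‖ ≤ 1 := by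
  have h := norm_integral_exp_smul_le (norm_comp_toNNReal_le h0 hS) hc
  rw [smul_smul, norm_smul, Real.norm_of_nonneg (by positivity), ← sq]
  calc _ ≤ c ^ 2 * (1 / c ^ 2) := by gcongr
    _ = 1 := by field_simp

/-- As a function of `s`, the product `S t * S s` vanishes at `0` and has derivative `S (t + s) - S
s`; integration by parts against `exp (-c * s)` gives the claim. -/
theorem mul_laplace_of_functionalEquation [CompleteSpace 𝔸]
    {S : ℝ≥0 → 𝔸} (h0 : S 0 = 0)
    (hS : ∀ t s : ℝ≥0, ‖S t - S s‖ ≤ |(t : ℝ) - (s : ℝ)|)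
    (hd : ∀ t s : ℝ≥0, S t * S s = (∫ r in (t : ℝ)..((t : ℝ) + (s : ℝ)), S r.toNNReal) -
      ∫ r in (0 : ℝ)..(s : ℝ), S r.toNNReal) {c : ℝ} (hc : 0 < c) {t : ℝ} (ht : 0 ≤ t) :
    S t.toNNReal * c • (∫ s in Ioi (0 : ℝ), Real.exp (-c * s) • S s.toNNReal) =
      (∫ s in Ioi (0 : ℝ), Real.exp (-c * s) • S (t + s).toNNReal) -
        ∫ s in Ioi (0 : ℝ), Real.exp (-c * s) • S s.toNNReal := by
  set f : ℝ → 𝔸 := fun t => S t.toNNReal with hf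
  have hfc : Continuous f := continuous_comp_toNNReal hS
  have hfb : ∀ t, 0 < t → ‖f t‖ ≤ 1 * t := norm_comp_toNNReal_le h0 hS
  have hfi := integrableOn_exp_smul hfc hfb hc
  set g : ℝ → 𝔸 := fun s => (∫ r in t..(t + s), f r) - ∫ r in (0 : ℝ)..s, f r with hg
  have hgS : ∀ s, 0 ≤ s → f t * f s = g s := by
    intro s hs
    have := hd t.toNNReal s.toNNReal
    rwa [Real.coe_toNNReal _ ht, Real.coe_toNNReal _ hs] at this
  have hgd : ∀ s, 0 ≤ s → HasDerivAt g ((0 : ℝ) • g s + (f (t + s) - f s)) s := by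
    intro s _
    rw [zero_smul, zero_add]
    refine HasDerivAt.sub ?_ (hfc.integral_hasStrictDerivAt 0 s).hasDerivAt
    exact (hfc.integral_hasStrictDerivAt t (t + s)).hasDerivAt.comp_const_add t s
  have hgb : ∀ s, 0 < s → ‖g s‖ ≤ ‖f t‖ * s := by
    intro s hs
    rw [← hgS s hs.le]
    exact (norm_mul_le _ _).trans (mul_le_mul_of_nonneg_left (by simpa using hfb s hs)
      (norm_nonneg _))
  have hgc : Continuous g := by
    refine Continuous.sub ?_ (intervalIntegral.continuous_primitive hfc.intervalIntegrable 0)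
    exact (intervalIntegral.continuous_primitive hfc.intervalIntegrable t).comp (continuous_const_add t)
  have hhi : IntegrableOn (fun s : ℝ => Real.exp (-c * s) • (f (t + s) - f s)) (Ioi 0) := by
    refine Integrable.mono' ((integrableOn_exp_neg_mul_Ioi_zero hc).const_mul t)
      (Continuous.aestronglyMeasurable (by fun_prop)) ?_
    refine (ae_restrict_iff' measurableSet_Ioi).2 (.of_forall fun s hs => ?_)
    rw [norm_smul, Real.norm_of_nonneg (Real.exp_pos _).le, mul_comm]
    have hs' : 0 ≤ s := le_of_lt hs
    have h1 := hS (t + s).toNNReal s.toNNReal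
    rw [Real.coe_toNNReal _ (by positivity), Real.coe_toNNReal _ hs', add_sub_cancel_right,
      abs_of_nonneg ht] at h1
    exact mul_le_mul_of_nonneg_right h1 (Real.exp_pos _).le
  have key := laplace_of_hasDerivAt hc hgd hgb (integrableOn_exp_smul hgc hgb hc) hhi
  have hsplit : ∫ s in Ioi (0 : ℝ), Real.exp (-c * s) • (f (t + s) - f s) =
      (∫ s in Ioi (0 : ℝ), Real.exp (-c * s) • f (t + s)) -
        ∫ s in Ioi (0 : ℝ), Real.exp (-c * s) • f s := by
    have hi2 : IntegrableOn (fun s : ℝ => Real.exp (-c * s) • f (t + s)) (Ioi 0) := by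
      refine (hhi.add hfi).congr (.of_forall fun s => ?_)
      simp [smul_sub]
    rw [← integral_sub hi2 hfi]
    simp only [smul_sub]
  have hg0 : g 0 = 0 := by simp [hg]
  rw [hsplit, hg0, zero_add, sub_zero] at key
  rw [← key, mul_smul_comm]
  congr 1
  rw [← integral_const_mul_of_integrable hfi]
  refine setIntegral_congr_fun measurableSet_Ioi fun s hs => ?_
  simp only [mul_smul_comm]
  rw [hgS s (le_of_lt hs)]

/-- The Laplace transforms of a solution of the functional equation form a pseudo-resolvent. -/
theorem resolvent_identity_of_functionalEquation [CompleteSpace 𝔸]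
    {S : ℝ≥0 → 𝔸} (h0 : S 0 = 0)
    (hS : ∀ t s : ℝ≥0, ‖S t - S s‖ ≤ |(t : ℝ) - (s : ℝ)|)
    (hd : ∀ t s : ℝ≥0, S t * S s = (∫ r in (t : ℝ)..((t : ℝ) + (s : ℝ)), S r.toNNReal) -
      ∫ r in (0 : ℝ)..(s : ℝ), S r.toNNReal) {R : ℝ → 𝔸}
    (hR : ∀ c : ℝ, 0 < c →
      R c = c • ∫ t in Ioi (0 : ℝ), Real.exp (-c * t) • S t.toNNReal)
    {b c : ℝ} (hb : 0 < b) (hc : 0 < c) :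
    R b - R c = (c - b) • (R b * R c) := by
  set f : ℝ → 𝔸 := fun t => S t.toNNReal with hf
  have hfc : Continuous f := continuous_comp_toNNReal hS
  have hfb : ∀ t, 0 < t → ‖f t‖ ≤ 1 * t := norm_comp_toNNReal_le h0 hS
  have hfi := fun {c : ℝ} (hc : 0 < c) => integrableOn_exp_smul hfc hfb hc
  set C := ∫ t in Ioi (0 : ℝ), Real.exp (-c * t) • f t with hC
  -- Closed form of `S t * R c` for `t ≥ 0`. It solves `H' = c H + (R c - f)` with `H 0 = 0`, so its
  -- transform at `b` yields the factor `b - c` of the resolvent identity.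
  set H : ℝ → 𝔸 := fun t => Real.exp (c * t) • (C - ∫ s in (0 : ℝ)..t, Real.exp (-c * s) • f s) - C
    with hH
  have hHS : ∀ t, 0 ≤ t → f t * R c = H t := by
    intro t ht
    rw [hR c hc, hH]
    simp only
    rw [mul_laplace_of_functionalEquation h0 hS hd hc ht]
    exact congrArg (· - C) (laplace_comp_add hfc (hfi hc))
  have hec : Continuous fun s : ℝ => Real.exp (-c * s) • f s := by fun_prop
  have hHd : ∀ t, 0 ≤ t → HasDerivAt H (c • H t + (R c - f t)) t := by
    intro t _
    have h1 : HasDerivAt (fun t : ℝ => Real.exp (c * t)) (Real.exp (c * t) * (c * 1)) t :=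
      ((hasDerivAt_id t).const_mul c).exp
    have h2 := ((h1.smul (((hec.integral_hasStrictDerivAt 0 t).hasDerivAt).const_sub C)).sub_const C)
    refine h2.congr_deriv ?_
    have h3 : Real.exp (c * t) • Real.exp (-c * t) • f t = f t := by
      rw [smul_smul, ← Real.exp_add]; simp
    rw [smul_neg, h3, hR c hc, hH]
    module
  have hHb : ∀ t, 0 < t → ‖H t‖ ≤ ‖R c‖ * t := by
    intro t ht
    rw [← hHS t ht.le, mul_comm ‖R c‖]
    exact (norm_mul_le _ _).trans (mul_le_mul_of_nonneg_right (by simpa using hfb t ht)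
      (norm_nonneg _))
  have hRi : IntegrableOn (fun t : ℝ => Real.exp (-b * t) • R c) (Ioi 0) :=
    (integrableOn_exp_neg_mul_Ioi_zero hb).smul_const _
  have hHi : EqOn (fun t : ℝ => (Real.exp (-b * t) • f t) * R c)
      (fun t : ℝ => Real.exp (-b * t) • H t) (Ioi 0) := by
    intro t ht
    simp only [smul_mul_assoc]
    rw [hHS t (le_of_lt ht)]
  have hsub : ∀ t : ℝ, Real.exp (-b * t) • (R c - f t) =
      Real.exp (-b * t) • R c - Real.exp (-b * t) • f t := fun t => smul_sub _ _ _
  have key := laplace_of_hasDerivAt hb hHd hHb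
    (IntegrableOn.congr_fun ((hfi hb).mul_const (R c)) hHi measurableSet_Ioi)
    (by simp only [hsub]; exact hRi.sub (hfi hb))
  have hH0 : H 0 = 0 := by simp [hH]
  simp only [hsub] at key
  rw [hH0, zero_add, integral_sub hRi (hfi hb), integral_smul_const,
    integral_exp_neg_mul_Ioi_zero hb, ← setIntegral_congr_fun measurableSet_Ioi hHi,
    integral_mul_const_of_integrable (hfi hb)] at key
  have h4 : ∫ t in Ioi (0 : ℝ), Real.exp (-b * t) • f t = (1 / b) • R b := by
    rw [hR b hb, smul_smul, one_div_mul_cancel hb.ne', one_smul]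
  rw [h4, smul_mul_assoc, ← smul_sub, smul_comm] at key
  have h5 := smul_right_injective 𝔸 (one_div_pos.2 hb).ne' key
  rw [← neg_sub (R c), ← h5]
  module

end FunctionalEquation

/-! ### Contraction semigroups of bounded generators and their primitives -/

section BoundedGenerator

open Filter Topology NormedSpace

variable {𝔸 : Type*} [NormedRing 𝔸] [NormedAlgebra ℝ 𝔸]

/-- Only `‖1‖ ≤ 1` is asked, since the identity operator has norm `0` on the zero space. -/
theorem norm_exp_le_exp_norm_of_norm_one_le (h1 : ‖(1 : 𝔸)‖ ≤ 1) (x : 𝔸) :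
    ‖exp x‖ ≤ Real.exp ‖x‖ := by
  rw [exp_eq_tsum ℝ, Real.exp_eq_exp_ℝ]
  simp only
  refine tsum_of_norm_bounded (exp_series_hasSum_exp' (𝕂 := ℝ) ‖x‖) fun n => ?_
  rw [norm_smul, smul_eq_mul, Real.norm_of_nonneg (by positivity)]
  gcongr
  rcases n.eq_zero_or_pos with rfl | hn
  · simpa using h1
  · exact norm_pow_le' x hn

variable [CompleteSpace 𝔸]

theorem intervalIntegral_mul_const {f : ℝ → 𝔸} {a b : ℝ} (hf : IntervalIntegrable f volume a b)
    (Z : 𝔸) : ∫ r in a..b, f r * Z = (∫ r in a..b, f r) * Z :=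
  ((ContinuousLinearMap.mul ℝ 𝔸).flip Z).intervalIntegral_comp_comm hf

theorem intervalIntegral_const_mul {f : ℝ → 𝔸} {a b : ℝ} (hf : IntervalIntegrable f volume a b)
    (Z : 𝔸) : ∫ r in a..b, Z * f r = Z * ∫ r in a..b, f r :=
  (ContinuousLinearMap.mul ℝ 𝔸 Z).intervalIntegral_comp_comm hf

/-- The scalar part splits off: the exponential is `exp (-tμ)` times `exp (tμ • μ • P)`, whose norm
is at most `exp (tμ)`. -/
theorem norm_exp_smul_le_of_contraction (h1 : ‖(1 : 𝔸)‖ ≤ 1) {P : 𝔸} {μ : ℝ} (hμ : 0 < μ)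
    (hP : ‖μ • P‖ ≤ 1) {t : ℝ} (ht : 0 ≤ t) : ‖exp (t • (μ ^ 2 • P - μ • (1 : 𝔸)))‖ ≤ 1 := by
  have e : t • (μ ^ 2 • P - μ • (1 : 𝔸)) =
      (t * μ) • μ • P + algebraMap ℝ 𝔸 (-(t * μ)) := by
    rw [Algebra.algebraMap_eq_smul_one]; module
  let +nondep : NormedAlgebra ℚ 𝔸 := NormedAlgebra.restrictScalars ℚ ℝ 𝔸
  rw [e, exp_add_of_commute (Algebra.commutes _ _).symm, ← algebraMap_exp_comm,
    ← Real.exp_eq_exp_ℝ, ← Algebra.commutes, ← Algebra.smul_def, norm_smul,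
    Real.norm_of_nonneg (Real.exp_pos _).le]
  have h2 : ‖exp ((t * μ) • μ • P)‖ ≤ Real.exp (t * μ) := by
    refine (norm_exp_le_exp_norm_of_norm_one_le h1 _).trans (Real.exp_le_exp.2 ?_)
    rw [norm_smul, Real.norm_of_nonneg (by positivity)]
    exact mul_le_of_le_one_right (by positivity) hP
  calc _ ≤ Real.exp (-(t * μ)) * Real.exp (t * μ) := by gcongr
    _ = 1 := by rw [← Real.exp_add]; simp

/-- The path `exp (s A) exp ((t - s) B) Z` joins the two terms, and its derivative is a product of
contractions with `(A - B) Z`. The factor `Z` stays because the Yosida generators converge only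
after multiplication by a suitable element. -/
theorem norm_exp_smul_sub_mul_le {A B : 𝔸} (hAB : Commute A B)
    (hA : ∀ t : ℝ, 0 ≤ t → ‖exp (t • A)‖ ≤ 1) (hB : ∀ t : ℝ, 0 ≤ t → ‖exp (t • B)‖ ≤ 1)
    (Z : 𝔸) {t : ℝ} (ht : 0 ≤ t) :
    ‖exp (t • A) * Z - exp (t • B) * Z‖ ≤ t * ‖A * Z - B * Z‖ := by
  set φ : ℝ → 𝔸 := fun s => exp (s • A) * (exp ((t - s) • B) * Z) with hφ
  have hd : ∀ s, HasDerivAt φ (exp (s • A) * (exp ((t - s) • B) * (A * Z - B * Z))) s := by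
    intro s
    have h1 := hasDerivAt_exp_smul_const (𝕂 := ℝ) A s
    have h2 : HasDerivAt (fun s : ℝ => exp ((t - s) • B)) (-(exp ((t - s) • B) * B)) s := by
      have := (hasDerivAt_exp_smul_const (𝕂 := ℝ) B (t - s)).scomp s
        ((hasDerivAt_id s).const_sub t)
      rw [neg_one_smul] at this
      exact this
    have hc : Commute A (exp ((t - s) • B)) := (hAB.smul_right (t - s)).exp_right
    refine (h1.mul (h2.mul_const Z)).congr_deriv ?_
    rw [mul_assoc (exp (s • A)) A, ← mul_assoc A, hc.eq]
    noncomm_ring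
  have h := norm_image_sub_le_of_norm_deriv_le_segment' (f := φ) (a := 0) (b := t)
    (C := ‖A * Z - B * Z‖) (fun s _ => (hd s).hasDerivWithinAt) (fun s hs => ?_) t ⟨ht, le_rfl⟩
  · simpa [hφ, mul_comm] using h
  · have hts : 0 ≤ t - s := by linarith [hs.2]
    calc _ ≤ ‖exp (s • A)‖ * (‖exp ((t - s) • B)‖ * ‖A * Z - B * Z‖) :=
          (norm_mul_le _ _).trans (mul_le_mul_of_nonneg_left (norm_mul_le _ _) (norm_nonneg _))
      _ ≤ 1 * (1 * ‖A * Z - B * Z‖) := by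
          gcongr
          · exact hA s hs.1
          · exact hB _ hts
      _ = _ := by ring

/-- The integrated semigroup `∫₀ᵗ exp (r B) dr` of a bounded operator `B`. -/
noncomputable def expPrimitive (B : 𝔸) (t : ℝ) : 𝔸 := ∫ r in (0 : ℝ)..t, exp (r • B)

theorem continuous_exp_smul (B : 𝔸) : Continuous fun r : ℝ => exp (r • B) :=
  (differentiable_exp_smul_const ℝ B).continuous

theorem hasDerivAt_expPrimitive (B : 𝔸) (t : ℝ) :
    HasDerivAt (expPrimitive B) (exp (t • B)) t :=
  ((continuous_exp_smul B).integral_hasStrictDerivAt 0 t).hasDerivAt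

theorem continuous_expPrimitive (B : 𝔸) : Continuous (expPrimitive B) :=
  intervalIntegral.continuous_primitive (continuous_exp_smul B).intervalIntegrable 0

theorem expPrimitive_mul (B : 𝔸) (t : ℝ) : expPrimitive B t * B = exp (t • B) - 1 := by
  have h := intervalIntegral.integral_eq_sub_of_hasDerivAt (a := 0) (b := t)
    (fun r _ => hasDerivAt_exp_smul_const (𝕂 := ℝ) B r)
    (((continuous_exp_smul B).mul_const B).intervalIntegrable _ _)
  rw [intervalIntegral_mul_const] at h
  · simpa [expPrimitive] using h
  · exact (continuous_exp_smul B).intervalIntegrable _ _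

theorem expPrimitive_mul_exp (B : 𝔸) (t s : ℝ) :
    expPrimitive B t * exp (s • B) = expPrimitive B (t + s) - expPrimitive B s := by
  have hi := fun a b => (continuous_exp_smul B).intervalIntegrable (μ := volume) a b
  rw [expPrimitive, expPrimitive, expPrimitive, intervalIntegral.integral_interval_sub_left
    (hi _ _) (hi _ _), ← intervalIntegral_mul_const (hi _ _)]
  have h := intervalIntegral.integral_comp_add_right (a := 0) (b := t)
    (fun r : ℝ => exp (r • B)) s
  rw [zero_add] at h
  rw [← h]
  refine intervalIntegral.integral_congr fun r _ => ?_
  simp only [add_smul]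
  let +nondep : NormedAlgebra ℚ 𝔸 := NormedAlgebra.restrictScalars ℚ ℝ 𝔸
  exact (exp_add_of_commute (((Commute.refl B).smul_left r).smul_right s)).symm

/-- The identity `expPrimitive_mul_exp` is integrated over its second time variable. -/
theorem expPrimitive_functionalEquation (B : 𝔸) (t s : ℝ) :
    expPrimitive B t * expPrimitive B s =
      (∫ r in t..(t + s), expPrimitive B r) - ∫ r in (0 : ℝ)..s, expPrimitive B r := by
  have hc := continuous_expPrimitive B
  rw [expPrimitive.eq_def B s, ← intervalIntegral_const_mul
    ((continuous_exp_smul B).intervalIntegrable _ _)]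
  simp only [expPrimitive_mul_exp]
  have hct : Continuous fun r => expPrimitive B (t + r) := hc.comp (continuous_const_add t)
  rw [intervalIntegral.integral_sub (hct.intervalIntegrable _ _) (hc.intervalIntegrable _ _),
    intervalIntegral.integral_comp_add_left, add_zero]

theorem norm_expPrimitive_sub_le {B : 𝔸} (hB : ∀ t : ℝ, 0 ≤ t → ‖exp (t • B)‖ ≤ 1) {t s : ℝ}
    (ht : 0 ≤ t) (hs : 0 ≤ s) : ‖expPrimitive B t - expPrimitive B s‖ ≤ |t - s| := by
  have hi := fun a b => (continuous_exp_smul B).intervalIntegrable (μ := volume) a b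
  rw [expPrimitive, expPrimitive, intervalIntegral.integral_interval_sub_left (hi _ _) (hi _ _)]
  rw [← one_mul |t - s|]
  refine intervalIntegral.norm_integral_le_of_norm_le_const fun r hr => hB r ?_
  exact (le_min hs ht).trans hr.1.le

/-- Rearranged: `c` times the transform is a left inverse of `c - B`. -/
theorem laplace_expPrimitive {B : 𝔸} (hB : ∀ t : ℝ, 0 ≤ t → ‖exp (t • B)‖ ≤ 1) {c : ℝ}
    (hc : 0 < c) :
    c • ∫ t in Ioi (0 : ℝ), Real.exp (-c * t) • expPrimitive B t =
      (1 / c) • (1 : 𝔸) + (∫ t in Ioi (0 : ℝ), Real.exp (-c * t) • expPrimitive B t) * B := by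
  have hSb : ∀ t, 0 < t → ‖expPrimitive B t‖ ≤ 1 * t := by
    intro t ht
    simpa [expPrimitive, abs_of_pos ht] using norm_expPrimitive_sub_le hB ht.le le_rfl
  have hi := integrableOn_exp_smul (continuous_expPrimitive B) hSb hc
  have h1i : IntegrableOn (fun t : ℝ => Real.exp (-c * t) • (1 : 𝔸)) (Ioi 0) :=
    (integrableOn_exp_neg_mul_Ioi_zero hc).smul_const _
  have hE : ∀ t : ℝ, Real.exp (-c * t) • exp (t • B) =
      Real.exp (-c * t) • (1 : 𝔸) + (Real.exp (-c * t) • expPrimitive B t) * B := by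
    intro t
    rw [smul_mul_assoc, expPrimitive_mul, ← smul_add, add_sub_cancel]
  have hiB : IntegrableOn (fun t : ℝ => (Real.exp (-c * t) • expPrimitive B t) * B) (Ioi 0) :=
    hi.mul_const B
  have key := laplace_of_hasDerivAt (g := expPrimitive B) (h := fun t => exp (t • B)) (a := 0) hc
    (fun t _ => by simpa using hasDerivAt_expPrimitive B t) hSb hi
    (by simp only [hE]; exact h1i.add hiB)
  simp only [hE] at key
  rw [integral_add h1i hiB, integral_smul_const, integral_exp_neg_mul_Ioi_zero hc,
    integral_mul_const_of_integrable hi] at key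
  simpa [expPrimitive] using key

end BoundedGenerator

/-! ### Transfer of the Cauchy property -/

section Limits

open Filter Topology

theorem CauchySeq.of_dist_le_mul {α β : Type*} [PseudoMetricSpace α] [PseudoMetricSpace β]
    {u : ℕ → α} {v : ℕ → β} (hu : CauchySeq u) {K : ℝ}
    (h : ∀ m n, dist (v m) (v n) ≤ K * dist (u m) (u n)) : CauchySeq v := by
  rw [Metric.cauchySeq_iff] at hu ⊢
  intro ε hε
  obtain ⟨N, hN⟩ := hu (ε / (|K| + 1)) (by positivity)
  refine ⟨N, fun m hm n hn => ?_⟩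
  have h1 := hN m hm n hn
  rw [lt_div_iff₀ (by positivity)] at h1
  nlinarith [h m n, le_abs_self K, dist_nonneg (x := u m) (y := u n)]

theorem cauchySeq_mul_of_tendsto {𝔸 : Type*} [NormedRing 𝔸] {e : ℕ → 𝔸} (he : ∀ n, ‖e n‖ ≤ 1)
    {Z : ℕ → 𝔸} {Y : 𝔸} (hZ : Tendsto Z atTop (𝓝 Y))
    (h : ∀ k, CauchySeq fun n => e n * Z k) : CauchySeq fun n => e n * Y := by
  rw [Metric.cauchySeq_iff]
  intro ε hε
  obtain ⟨k, hk⟩ := ((Metric.tendsto_atTop.1 hZ) (ε / 3) (by positivity))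
  have hk := hk k le_rfl
  obtain ⟨N, hN⟩ := Metric.cauchySeq_iff.1 (h k) (ε / 3) (by positivity)
  refine ⟨N, fun m hm n hn => ?_⟩
  have h1 : ∀ j, dist (e j * Z k) (e j * Y) < ε / 3 := by
    intro j
    rw [dist_eq_norm, ← mul_sub]
    refine lt_of_le_of_lt (norm_mul_le _ _) ?_
    rw [dist_eq_norm] at hk
    nlinarith [he j, norm_nonneg (Z k - Y)]
  have h2 := dist_triangle4 (e m * Y) (e m * Z k) (e n * Z k) (e n * Y)
  have h3 := h1 m
  rw [dist_comm] at h3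
  linarith [h1 n, hN m hm n hn]

end Limits

/-! ### Yosida approximation and the generation theorem -/

section Generation

open Filter Topology NormedSpace

variable {𝔸 : Type*} [NormedRing 𝔸]

theorem pseudoResolvent_comm [NormedSpace ℝ 𝔸] {R : ℝ → 𝔸}
    (hR : ∀ b c : ℝ, 0 < b → 0 < c → R b - R c = (c - b) • (R b * R c))
    {b c : ℝ} (hb : 0 < b) (hc : 0 < c) : Commute (R b) (R c) := by
  rcases eq_or_ne b c with rfl | h
  · exact Commute.refl _
  have h1 := hR b c hb hc
  rw [← neg_sub, hR c b hc hb, ← neg_smul, neg_sub] at h1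
  exact (smul_right_injective 𝔸 (sub_ne_zero.2 h.symm) h1).symm

variable [NormedAlgebra ℝ 𝔸]

/-- The Yosida approximation `μ² R(μ) - μ` of the generator of the pseudo-resolvent `R`. -/
def yosida (R : ℝ → 𝔸) (μ : ℝ) : 𝔸 := μ ^ 2 • R μ - μ • (1 : 𝔸)

variable {R : ℝ → 𝔸}

theorem yosida_mul (hR : ∀ b c : ℝ, 0 < b → 0 < c → R b - R c = (c - b) • (R b * R c))
    {μ c : ℝ} (hμ : 0 < μ) (hc : 0 < c) :
    yosida R μ * R c = μ • R μ * (c • R c - 1) := by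
  have h := hR μ c hμ hc
  simp only [yosida, sub_mul, mul_sub, smul_mul_assoc, mul_smul_comm, one_mul, mul_one]
  linear_combination (norm := module) μ • h

theorem commute_yosida (hR : ∀ b c : ℝ, 0 < b → 0 < c → R b - R c = (c - b) • (R b * R c))
    {b c : ℝ} (hb : 0 < b) (hc : 0 < c) : Commute (yosida R b) (yosida R c) := by
  have h := pseudoResolvent_comm hR hb hc
  refine Commute.sub_left (Commute.sub_right ?_ ?_) ?_
  · exact (h.smul_left _).smul_right _
  · exact (Commute.one_right _).smul_right _
  · exact (Commute.one_left _).smul_left _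

theorem norm_smul_sub_one_le (h1 : ‖(1 : 𝔸)‖ ≤ 1)
    (hb : ∀ c : ℝ, 0 < c → ‖c • R c‖ ≤ 1) {c : ℝ} (hc : 0 < c) : ‖c • R c - 1‖ ≤ 2 :=
  (norm_sub_le _ _).trans (by linarith [hb c hc])

theorem norm_pseudoResolvent_le (hb : ∀ c : ℝ, 0 < c → ‖c • R c‖ ≤ 1) {c : ℝ} (hc : 0 < c) :
    ‖R c‖ ≤ 1 / c := by
  have := hb c hc
  rw [norm_smul, Real.norm_of_nonneg hc.le] at this
  rwa [le_div_iff₀ hc, mul_comm]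

/-- The Yosida approximations converge on `R(1)²`. -/
theorem norm_yosida_mul_sq_sub_le (h1 : ‖(1 : 𝔸)‖ ≤ 1)
    (hR : ∀ b c : ℝ, 0 < b → 0 < c → R b - R c = (c - b) • (R b * R c))
    (hb : ∀ c : ℝ, 0 < c → ‖c • R c‖ ≤ 1) {μ : ℝ} (hμ : 0 < μ) :
    ‖yosida R μ * (R 1 * R 1) - R 1 * (R 1 - 1)‖ ≤ 4 / μ := by
  have hy := yosida_mul hR hμ one_pos
  have h := hR μ 1 hμ one_pos
  have hc := (pseudoResolvent_comm hR hμ one_pos).eq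
  -- The error is exactly `R μ`, of norm at most `1 / μ`, times `(R 1 - 1) ^ 2`, of norm at most
  -- `4`.
  have e : yosida R μ * (R 1 * R 1) - R 1 * (R 1 - 1) = R μ * ((R 1 - 1) * (R 1 - 1)) := by
    have h' : μ • R μ * R 1 = R 1 + R μ * (R 1 - 1) := by
      simp only [mul_sub, smul_mul_assoc, mul_one]
      linear_combination (norm := module) h
    rw [← mul_assoc, hy, one_smul, mul_assoc,
      show (R 1 - 1) * R 1 = R 1 * (R 1 - 1) by rw [mul_sub, sub_mul, mul_one, one_mul],
      ← mul_assoc, h']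
    noncomm_ring
  have h2 : ‖R 1 - 1‖ ≤ 2 := by simpa using norm_smul_sub_one_le h1 hb one_pos
  rw [e]
  calc _ ≤ ‖R μ‖ * (‖R 1 - 1‖ * ‖R 1 - 1‖) :=
        (norm_mul_le _ _).trans (mul_le_mul_of_nonneg_left (norm_mul_le _ _) (norm_nonneg _))
    _ ≤ (1 / μ) * (2 * 2) := by
        gcongr
        exact norm_pseudoResolvent_le hb hμ
    _ = 4 / μ := by ring

theorem tendsto_smul_mul_self (h1 : ‖(1 : 𝔸)‖ ≤ 1)
    (hR : ∀ b c : ℝ, 0 < b → 0 < c → R b - R c = (c - b) • (R b * R c))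
    (hb : ∀ c : ℝ, 0 < c → ‖c • R c‖ ≤ 1) :
    Tendsto (fun k : ℕ => R 1 * (((k : ℝ) + 1) • R ((k : ℝ) + 1))) atTop (𝓝 (R 1)) := by
  rw [tendsto_iff_norm_sub_tendsto_zero]
  refine squeeze_zero (fun _ => norm_nonneg _) (fun k => ?_)
    (by simpa only [mul_zero] using tendsto_one_div_add_atTop_nhds_zero_nat.const_mul (2 : ℝ))
  have hk : (0 : ℝ) < (k : ℝ) + 1 := by positivity
  have h := hR _ 1 hk one_pos
  have hc := (pseudoResolvent_comm hR hk one_pos).eq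
  have e : R 1 * (((k : ℝ) + 1) • R ((k : ℝ) + 1)) - R 1 =
      R ((k : ℝ) + 1) * ((1 : ℝ) • R 1 - 1) := by
    simp only [mul_sub, mul_smul_comm, mul_one, ← hc]
    linear_combination (norm := module) h
  rw [e, mul_comm (2 : ℝ)]
  refine (norm_mul_le _ _).trans ?_
  exact mul_le_mul (norm_pseudoResolvent_le hb hk) (norm_smul_sub_one_le h1 hb one_pos)
    (norm_nonneg _) (one_div_pos.2 hk).le

variable [CompleteSpace 𝔸]

theorem norm_exp_smul_yosida_le (h1 : ‖(1 : 𝔸)‖ ≤ 1)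
    (hb : ∀ c : ℝ, 0 < c → ‖c • R c‖ ≤ 1) {μ : ℝ} (hμ : 0 < μ) (t : ℝ) (ht : 0 ≤ t) :
    ‖exp (t • yosida R μ)‖ ≤ 1 :=
  norm_exp_smul_le_of_contraction h1 hμ (hb μ hμ) ht

/-- On `R 1 * R 1` the generators converge, hence so do the semigroups. Contractivity extends this
to norm limits of right multiples of `R 1 * R 1`, and `R 1` is such a limit by
`tendsto_smul_mul_self`. -/
theorem cauchySeq_exp_yosida_mul (h1 : ‖(1 : 𝔸)‖ ≤ 1)
    (hR : ∀ b c : ℝ, 0 < b → 0 < c → R b - R c = (c - b) • (R b * R c))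
    (hb : ∀ c : ℝ, 0 < c → ‖c • R c‖ ≤ 1) {t : ℝ} (ht : 0 ≤ t) :
    CauchySeq fun n : ℕ => exp (t • yosida R ((n : ℝ) + 1)) * R 1 := by
  have hpos : ∀ n : ℕ, (0 : ℝ) < (n : ℝ) + 1 := fun n => by positivity
  have hB : CauchySeq fun n : ℕ => yosida R ((n : ℝ) + 1) * (R 1 * R 1) := by
    refine Tendsto.cauchySeq (x := R 1 * (R 1 - 1)) ?_
    rw [tendsto_iff_norm_sub_tendsto_zero]
    refine squeeze_zero (fun _ => norm_nonneg _)
      (fun n => norm_yosida_mul_sq_sub_le h1 hR hb (hpos n)) ?_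
    simpa [div_eq_mul_inv] using tendsto_one_div_add_atTop_nhds_zero_nat.const_mul (4 : ℝ)
  have hE : CauchySeq fun n : ℕ => exp (t • yosida R ((n : ℝ) + 1)) * (R 1 * R 1) := by
    refine hB.of_dist_le_mul (K := t) fun m n => ?_
    rw [dist_eq_norm, dist_eq_norm]
    exact norm_exp_smul_sub_mul_le (commute_yosida hR (hpos m) (hpos n))
      (norm_exp_smul_yosida_le h1 hb (hpos m)) (norm_exp_smul_yosida_le h1 hb (hpos n)) _ ht
  refine cauchySeq_mul_of_tendsto (fun n => norm_exp_smul_yosida_le h1 hb (hpos n) t ht)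
    (tendsto_smul_mul_self h1 hR hb) fun k => ?_
  have hk := hpos k
  -- The resolvent identity between `1` and `k + 1` factors `R (k + 1)` through `R 1`.
  have e : R 1 * (((k : ℝ) + 1) • R ((k : ℝ) + 1)) =
      (R 1 * R 1) * (((k : ℝ) + 1) • (1 - (k : ℝ) • R ((k : ℝ) + 1))) := by
    have h := hR 1 ((k : ℝ) + 1) one_pos hk
    have h' : R ((k : ℝ) + 1) = R 1 * (1 - (k : ℝ) • R ((k : ℝ) + 1)) := by
      simp only [mul_sub, mul_smul_comm, mul_one]
      linear_combination (norm := module) (-1 : ℝ) • h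
    rw [mul_smul_comm, mul_smul_comm, mul_assoc, ← h']
  rw [e]
  refine hE.of_dist_le_mul (K := ‖((k : ℝ) + 1) • ((1 : 𝔸) - (k : ℝ) • R ((k : ℝ) + 1))‖)
    fun m n => ?_
  rw [dist_eq_norm, dist_eq_norm, ← mul_assoc _ (R 1 * R 1), ← mul_assoc _ (R 1 * R 1),
    ← sub_mul, mul_comm ‖_‖]
  exact norm_mul_le _ _

/-- Writing `1 = R 1 - B R 1 - (1/μ) B (1 - R 1)` with `B` the Yosida approximation, and using
`expPrimitive B t * B = exp (t B) - 1`, leaves only terms whose convergence is known: those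
containing `exp (r B) R 1`, and one of size `O(1/μ)`. -/
theorem expPrimitive_yosida_eq
    (hR : ∀ b c : ℝ, 0 < b → 0 < c → R b - R c = (c - b) • (R b * R c))
    {μ : ℝ} (hμ : 0 < μ) (t : ℝ) :
    expPrimitive (yosida R μ) t = (∫ r in (0 : ℝ)..t, exp (r • yosida R μ) * R 1) -
      (exp (t • yosida R μ) * R 1 - R 1) -
      (1 / μ) • ((exp (t • yosida R μ) - 1) * (1 - R 1)) := by
  have hy := yosida_mul hR hμ one_pos
  rw [one_smul] at hy
  have e : (1 : 𝔸) = R 1 - yosida R μ * R 1 - (1 / μ) • (yosida R μ * (1 - R 1)) := by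
    have h2 : (1 / μ) • yosida R μ = μ • R μ - 1 := by
      rw [yosida, smul_sub, smul_smul, smul_smul, one_div_mul_cancel hμ.ne', one_smul]
      congr 2
      field_simp
    rw [hy, ← smul_mul_assoc, h2]
    noncomm_ring
  rw [intervalIntegral_mul_const ((continuous_exp_smul _).intervalIntegrable _ _),
    ← expPrimitive.eq_def]
  conv_lhs => rw [← mul_one (expPrimitive _ _), e]
  rw [mul_sub, mul_sub, mul_smul_comm, ← mul_assoc, ← mul_assoc, expPrimitive_mul, sub_mul _ 1,
    one_mul]

theorem exists_tendsto_expPrimitive_yosida (h1 : ‖(1 : 𝔸)‖ ≤ 1)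
    (hR : ∀ b c : ℝ, 0 < b → 0 < c → R b - R c = (c - b) • (R b * R c))
    (hb : ∀ c : ℝ, 0 < c → ‖c • R c‖ ≤ 1) {t : ℝ} (ht : 0 ≤ t) :
    ∃ Z, Tendsto (fun n : ℕ => expPrimitive (yosida R ((n : ℝ) + 1)) t) atTop (𝓝 Z) := by
  have hpos : ∀ n : ℕ, (0 : ℝ) < (n : ℝ) + 1 := fun n => by positivity
  have hV : ∀ r : ℝ, ∃ V, 0 ≤ r →
      Tendsto (fun n : ℕ => exp (r • yosida R ((n : ℝ) + 1)) * R 1) atTop (𝓝 V) := by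
    intro r
    by_cases hr : 0 ≤ r
    · obtain ⟨V, hV⟩ := cauchySeq_tendsto_of_complete (cauchySeq_exp_yosida_mul h1 hR hb hr)
      exact ⟨V, fun _ => hV⟩
    · exact ⟨0, fun h => absurd h hr⟩
  choose V hV using hV
  have hI : Tendsto (fun n : ℕ => ∫ r in (0 : ℝ)..t, exp (r • yosida R ((n : ℝ) + 1)) * R 1)
      atTop (𝓝 (∫ r in (0 : ℝ)..t, V r)) := by
    refine intervalIntegral.tendsto_integral_filter_of_dominated_convergence (fun _ => ‖R 1‖)
      (.of_forall fun n => ?_) (.of_forall fun n => .of_forall fun r hr => ?_)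
      intervalIntegrable_const (.of_forall fun r hr => hV r ?_)
    · exact ((continuous_exp_smul _).mul_const _).aestronglyMeasurable
    · rw [uIoc_of_le ht] at hr
      refine (norm_mul_le _ _).trans (mul_le_of_le_one_left (norm_nonneg _) ?_)
      exact norm_exp_smul_yosida_le h1 hb (hpos n) r hr.1.le
    · rw [uIoc_of_le ht] at hr
      exact hr.1.le
  have h0 : Tendsto (fun n : ℕ => (1 / ((n : ℝ) + 1)) •
      ((exp (t • yosida R ((n : ℝ) + 1)) - 1) * (1 - R 1))) atTop (𝓝 0) := by
    refine squeeze_zero_norm (fun n => ?_)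
      (by simpa only [zero_mul] using
        tendsto_one_div_add_atTop_nhds_zero_nat.mul_const (2 * ‖1 - R 1‖))
    rw [norm_smul, Real.norm_of_nonneg (one_div_pos.2 (hpos n)).le]
    gcongr
    refine (norm_mul_le _ _).trans ?_
    gcongr
    exact (norm_sub_le _ _).trans
      (by linarith [norm_exp_smul_yosida_le h1 hb (hpos n) t ht])
  have hlim := (hI.sub ((hV t ht).sub_const (R 1))).sub h0
  exact ⟨_, hlim.congr fun n => (expPrimitive_yosida_eq hR (hpos n) t).symm⟩

theorem norm_sub_laplace_expPrimitive_yosida_le (h1 : ‖(1 : 𝔸)‖ ≤ 1)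
    (hR : ∀ b c : ℝ, 0 < b → 0 < c → R b - R c = (c - b) • (R b * R c))
    (hb : ∀ c : ℝ, 0 < c → ‖c • R c‖ ≤ 1) {μ c : ℝ} (hμ : 0 < μ) (hc : 0 < c) :
    ‖(c • ∫ t in Ioi (0 : ℝ), Real.exp (-c * t) • expPrimitive (yosida R μ) t) - R c‖ ≤
      4 / μ := by
  have hE := norm_exp_smul_yosida_le h1 hb hμ
  have hl := laplace_expPrimitive hE hc
  have hLb := norm_integral_exp_smul_le (f := expPrimitive (yosida R μ)) (K := 1)
    (fun t ht => by
      simpa [expPrimitive, abs_of_pos ht] using norm_expPrimitive_sub_le hE ht.le le_rfl) hc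
  set L := ∫ t in Ioi (0 : ℝ), Real.exp (-c * t) • expPrimitive (yosida R μ) t
  have hy := yosida_mul hR hμ hc
  have h := hR μ c hμ hc
  -- A combination of `hl`, of `hl` times `R c`, and of `L` times the resolvent identity. The right
  -- side has norm at most `2 + 2`, whence the `4`.
  have e : μ • (c • L - R c) = c ^ 2 • (L * ((μ • R μ) * (c • R c - 1))) - (c ^ 2 • L - 1) := by
    have hl1 : c ^ 2 • L = 1 + c • (μ ^ 2 • (L * R μ) - μ • L) := by
      have := congrArg (c • ·) hl
      simp only [yosida, mul_sub, mul_smul_comm, mul_one, smul_add, smul_smul,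
        mul_one_div_cancel hc.ne', one_smul] at this
      linear_combination (norm := module) this
    have hl2 : c ^ 2 • (L * R c) = R c + c • (L * (yosida R μ * R c)) := by
      have := congrArg (c • · * R c) hl
      simp only [add_mul, smul_mul_assoc, one_mul, smul_add, smul_smul,
        mul_one_div_cancel hc.ne', one_smul, mul_assoc] at this
      linear_combination (norm := module) this
    have hl3 := congrArg (L * ·) h
    rw [hy] at hl2
    simp only [mul_sub, mul_smul_comm, smul_mul_assoc, mul_one] at hl2 hl3 ⊢
    linear_combination (norm := module) hl1 + μ • hl2 + (μ * c ^ 2) • hl3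
  have hcL : ‖c ^ 2 • L‖ ≤ 1 := by
    rw [norm_smul, Real.norm_of_nonneg (by positivity)]
    calc _ ≤ c ^ 2 * (1 / c ^ 2) := by gcongr
      _ = 1 := by field_simp
  have hn : ‖μ • (c • L - R c)‖ ≤ 4 := by
    rw [e, ← smul_mul_assoc]
    have h2 := norm_smul_sub_one_le h1 hb hc
    have h3 : ‖(c ^ 2 • L) * ((μ • R μ) * (c • R c - 1))‖ ≤ 1 * (1 * 2) := by
      refine (norm_mul_le _ _).trans ?_
      gcongr
      refine (norm_mul_le _ _).trans ?_
      gcongr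
      exact hb μ hμ
    have h4 := norm_sub_le ((c ^ 2 • L) * ((μ • R μ) * (c • R c - 1))) (c ^ 2 • L - 1)
    have h5 := norm_sub_le (c ^ 2 • L) 1
    linarith
  rw [norm_smul, Real.norm_of_nonneg hμ.le] at hn
  rwa [le_div_iff₀ hμ, mul_comm]

/-- **Generation theorem**: a contractive pseudo-resolvent is the Laplace transform of an integrated
semigroup. -/
theorem exists_integratedSemigroup (h1 : ‖(1 : 𝔸)‖ ≤ 1)
    (hR : ∀ b c : ℝ, 0 < b → 0 < c → R b - R c = (c - b) • (R b * R c))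
    (hb : ∀ c : ℝ, 0 < c → ‖c • R c‖ ≤ 1) :
    ∃ S : ℝ≥0 → 𝔸, S 0 = 0 ∧ (∀ t s : ℝ≥0, ‖S t - S s‖ ≤ |(t : ℝ) - (s : ℝ)|) ∧
      (∀ c : ℝ, 0 < c → R c = c • ∫ t in Ioi (0 : ℝ), Real.exp (-c * t) • S t.toNNReal) ∧
      ∀ t s : ℝ≥0, S t * S s = (∫ r in (t : ℝ)..((t : ℝ) + (s : ℝ)), S r.toNNReal) -
        ∫ r in (0 : ℝ)..(s : ℝ), S r.toNNReal := by
  have hpos : ∀ n : ℕ, (0 : ℝ) < (n : ℝ) + 1 := fun n => by positivity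
  set T : ℕ → ℝ → 𝔸 := fun n => expPrimitive (yosida R ((n : ℝ) + 1)) with hT
  have hTb : ∀ n t, 0 ≤ t → ‖T n t‖ ≤ t := fun n t ht => by
    simpa [hT, expPrimitive, abs_of_nonneg ht] using
      norm_expPrimitive_sub_le (norm_exp_smul_yosida_le h1 hb (hpos n)) ht le_rfl
  choose S hS using fun t : ℝ≥0 => exists_tendsto_expPrimitive_yosida h1 hR hb t.coe_nonneg
  have hS' : ∀ t : ℝ, 0 ≤ t → Tendsto (fun n => T n t) atTop (𝓝 (S t.toNNReal)) := by
    intro t ht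
    simpa only [Real.coe_toNNReal t ht] using hS t.toNNReal
  have hint : ∀ a b : ℝ, 0 ≤ a → a ≤ b →
      Tendsto (fun n => ∫ r in a..b, T n r) atTop (𝓝 (∫ r in a..b, S r.toNNReal)) := by
    intro a b ha hab
    refine intervalIntegral.tendsto_integral_filter_of_dominated_convergence (fun r => r)
      (.of_forall fun n => (continuous_expPrimitive _).aestronglyMeasurable)
      (.of_forall fun n => .of_forall fun r hr => ?_)
      (continuous_id.intervalIntegrable _ _) (.of_forall fun r hr => hS' r ?_)
    all_goals rw [uIoc_of_le hab] at hr
    · exact hTb n r (ha.trans hr.1.le)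
    · exact ha.trans hr.1.le
  refine ⟨S, ?_, fun t s => ?_, fun c hc => ?_, fun t s => ?_⟩
  · refine tendsto_nhds_unique (hS 0) ?_
    simp [expPrimitive]
  · exact le_of_tendsto ((hS t).sub (hS s)).norm (.of_forall fun n =>
      norm_expPrimitive_sub_le (norm_exp_smul_yosida_le h1 hb (hpos n)) t.2 s.2)
  · have hlim : Tendsto
        (fun n => c • ∫ t in Ioi (0 : ℝ), Real.exp (-c * t) • T n t) atTop (𝓝 (R c)) := by
      rw [tendsto_iff_norm_sub_tendsto_zero]
      refine squeeze_zero (fun _ => norm_nonneg _)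
        (fun n => norm_sub_laplace_expPrimitive_yosida_le h1 hR hb (hpos n) hc) ?_
      simpa [div_eq_mul_inv] using tendsto_one_div_add_atTop_nhds_zero_nat.const_mul (4 : ℝ)
    refine tendsto_nhds_unique hlim (Tendsto.const_smul ?_ c)
    refine tendsto_integral_of_dominated_convergence _ (fun n => ?_)
      (integrableOn_exp_neg_mul_mul_id hc) (fun n => ?_) ?_
    · have := continuous_expPrimitive (yosida R ((n : ℝ) + 1))
      exact Continuous.aestronglyMeasurable (by fun_prop)
    · refine (ae_restrict_iff' measurableSet_Ioi).2 (.of_forall fun t ht => ?_)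
      rw [norm_smul, Real.norm_of_nonneg (Real.exp_pos _).le]
      gcongr
      exact hTb n t (le_of_lt ht)
    · refine (ae_restrict_iff' measurableSet_Ioi).2 (.of_forall fun t ht => ?_)
      exact (hS' t (le_of_lt ht)).const_smul _
  · refine tendsto_nhds_unique ((hS t).mul (hS s)) ?_
    refine ((hint t (t + s) t.2 (by simp)).sub (hint 0 s le_rfl s.2)).congr fun n => ?_
    exact (expPrimitive_functionalEquation _ _ _).symm

end Generation

/-! ### Relations, resolvents and pseudo-resolvents -/

namespace LinRel

section Resolvent

variable {𝕜 X : Type*} [RCLike 𝕜] [NormedAddCommGroup X] [NormedSpace 𝕜 X]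

theorem mem_resolventSet_and_resolvent_eq {A : LinRel 𝕜 X} {c : 𝕜} {Q : X →L[𝕜] X}
    (hQ : ∀ x z, (x, z) ∈ shift c A ↔ x = Q z) :
    c ∈ resolventSet A ∧ resolvent A c = Q := by
  have hex : ∃ Q : X →L[𝕜] X, inv (shift c A) = (Q : X →ₗ[𝕜] X).graph := by
    refine ⟨Q, ?_⟩
    ext ⟨z, x⟩
    rw [mem_inv, LinearMap.mem_graph_iff]
    exact hQ x z
  refine ⟨⟨?_, ?_, ?_⟩, ?_⟩
  · have : (shift c A : Set (X × X)) = {p | p.1 = Q p.2} := by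
      ext ⟨x, z⟩
      exact hQ x z
    rw [this]
    exact isClosed_eq continuous_fst (Q.continuous.comp continuous_snd)
  · ext x
    simp [ker, hQ]
  · ext z
    simp [ran, hQ]
  · have hs := hex.choose_spec
    rw [resolvent, dif_pos hex]
    -- Every operator with this graph equals `Q`, so the choice is immaterial.
    generalize hex.choose = P at hs ⊢
    ext z
    have h : (z, P z) ∈ inv (shift c A) := by
      rw [hs, LinearMap.mem_graph_iff]; rfl
    exact (hQ _ _).1 (mem_inv.1 h)

theorem mem_shift_iff_eq_resolvent [CompleteSpace X] {A : LinRel 𝕜 X} {c : 𝕜}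
    (hc : c ∈ resolventSet A) (x z : X) : (x, z) ∈ shift c A ↔ x = resolvent A c z := by
  rw [← mem_inv, inv_shift_eq_graph_resolvent hc, LinearMap.mem_graph_iff]
  rfl

theorem mem_shift_shift {A : LinRel 𝕜 X} {b c : 𝕜} {x z : X} :
    (x, z) ∈ shift c A ↔ (x, (b - c) • x + z) ∈ shift b A := by
  rw [mem_shift, mem_shift]
  have : b • x - ((b - c) • x + z) = c • x - z := by module
  rw [this]

theorem shift_injective {A B : LinRel 𝕜 X} {c : 𝕜} (h : shift c A = shift c B) : A = B := by
  ext ⟨x, y⟩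
  have h1 : ∀ A : LinRel 𝕜 X, (x, y) ∈ A ↔ (x, c • x - y) ∈ shift c A := fun A => by
    rw [mem_shift, sub_sub_cancel]
  rw [h1, h1, h]

/-- The resolvent identity for a relation. -/
theorem sub_eq_smul_mul_of_mem_shift_iff {A : LinRel 𝕜 X} {b c : 𝕜} {Q P : X →L[𝕜] X}
    (hQ : ∀ x z, (x, z) ∈ shift b A ↔ x = Q z) (hP : ∀ x z, (x, z) ∈ shift c A ↔ x = P z) :
    Q - P = (c - b) • (Q * P) := by
  ext z
  have h := (hQ _ _).1 (mem_shift_shift.1 ((hP (P z) z).2 rfl))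
  rw [map_add, map_smul] at h
  change Q z - P z = (c - b) • Q (P z)
  linear_combination (norm := module) -(1 : 𝕜) • h

/-- Dissipativity at `(x, c x - z)` reads `c ‖x‖ ≤ ‖z‖`, which gives injectivity and the operator
bound at once. -/
theorem Dissipative.exists_resolvent {A : LinRel 𝕜 X} (hA : Dissipative A) {c : ℝ} (hc : 0 < c)
    (hran : ran (shift (c : 𝕜) A) = univ) :
    ∃ Q : X →L[𝕜] X, (∀ x z, (x, z) ∈ shift (c : 𝕜) A ↔ x = Q z) ∧ ‖Q‖ ≤ 1 / c := by
  have hex : ∀ z, ∃ x, (x, z) ∈ shift (c : 𝕜) A := fun z => by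
    have : z ∈ ran (shift (c : 𝕜) A) := by rw [hran]; trivial
    exact this
  have hb : ∀ x z, (x, z) ∈ shift (c : 𝕜) A → ‖x‖ ≤ 1 / c * ‖z‖ := by
    intro x z h
    have := hA _ _ (mem_shift.1 h) c hc
    rw [sub_sub_cancel, norm_smul, RCLike.norm_ofReal, abs_of_pos hc] at this
    rwa [one_div, inv_mul_eq_div, le_div_iff₀ hc, mul_comm]
  have huniq : ∀ x x' z, (x, z) ∈ shift (c : 𝕜) A → (x', z) ∈ shift (c : 𝕜) A → x = x' := by
    intro x x' z h h'
    have h0 := (shift (c : 𝕜) A).sub_mem h h'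
    rw [Prod.mk_sub_mk, sub_self] at h0
    simpa [sub_eq_zero] using hb _ _ h0
  choose f hf using hex
  let L : X →ₗ[𝕜] X :=
    { toFun := f
      map_add' := fun a b => huniq _ _ _ (hf (a + b)) ((shift _ A).add_mem (hf a) (hf b))
      map_smul' := fun k a => huniq _ _ _ (hf (k • a)) ((shift _ A).smul_mem k (hf a)) }
  refine ⟨L.mkContinuous (1 / c) fun z => hb _ _ (hf z), fun x z => ⟨fun h => ?_, ?_⟩,
    L.mkContinuous_norm_le (by positivity) _⟩
  · exact huniq _ _ _ h (hf z)
  · rintro rfl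
    exact hf z

/-- Solving for `z` amounts to `x = Q w` with `w - (b - c) Q w = z`, and `1 - (b - c) Q` is
invertible by the Neumann series. -/
theorem ran_shift_eq_univ_of_abs_sub_lt [CompleteSpace X] {A : LinRel 𝕜 X} {b c : ℝ}
    (hb : 0 < b) {Q : X →L[𝕜] X}
    (hQ : ∀ x z, (x, z) ∈ shift (b : 𝕜) A ↔ x = Q z) (hQb : ‖Q‖ ≤ 1 / b) (h : |b - c| < b) :
    ran (shift (c : 𝕜) A) = univ := by
  have hn : ‖((b - c : ℝ) : 𝕜) • Q‖ < 1 := by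
    rw [norm_smul, RCLike.norm_ofReal]
    calc _ ≤ |b - c| * (1 / b) := by gcongr
      _ < 1 := by rwa [mul_one_div, div_lt_one hb]
  set u := Units.oneSub _ hn with hu
  refine eq_univ_of_forall fun z => ⟨Q ((↑u⁻¹ : X →L[𝕜] X) z), ?_⟩
  rw [mem_shift_shift (b := (b : 𝕜)), hQ]
  have h1 : (u : X →L[𝕜] X) * (↑u⁻¹ : X →L[𝕜] X) = 1 := u.mul_inv
  have h2 := DFunLike.congr_fun h1 z
  rw [hu, Units.val_oneSub] at h2
  change (↑u⁻¹ : X →L[𝕜] X) z - ((b - c : ℝ) : 𝕜) • Q ((↑u⁻¹ : X →L[𝕜] X) z) = z at h2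
  congr 1
  rw [← RCLike.ofReal_sub]
  exact (sub_eq_iff_eq_add'.1 h2)

theorem MDissipative.ran_shift_eq_univ [CompleteSpace X] {A : LinRel 𝕜 X} (hA : MDissipative A)
    {c : ℝ} (hc : 0 < c) : ran (shift (c : 𝕜) A) = univ := by
  obtain ⟨hd, b, hb, hran⟩ := hA
  have step : ∀ b c : ℝ, 0 < b → 0 < c → c < 2 * b → ran (shift (b : 𝕜) A) = univ →
      ran (shift (c : 𝕜) A) = univ := by
    intro b c hb hc hcb hran
    obtain ⟨Q, hQ, hQb⟩ := hd.exists_resolvent hb hran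
    exact ran_shift_eq_univ_of_abs_sub_lt hb hQ hQb (abs_lt.2 ⟨by linarith, by linarith⟩)
  -- One step reaches every point of `(0, 2b)`, so only moving upwards needs iteration; any ratio
  -- strictly between `1` and `2` would do.
  have hpow : ∀ n : ℕ, ran (shift (((3 / 2) ^ n * b : ℝ) : 𝕜) A) = univ := by
    intro n
    induction n with
    | zero => simpa using hran
    | succ n ih =>
      have hp : 0 < (3 / 2 : ℝ) ^ n * b := by positivity
      exact step _ _ hp (by positivity) (by rw [pow_succ]; linarith) ih
  obtain ⟨n, hn⟩ := pow_unbounded_of_one_lt (c / b) (by norm_num : (1 : ℝ) < 3 / 2)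
  rw [div_lt_iff₀ hb] at hn
  exact step _ _ (by positivity) hc (by linarith) (hpow n)

theorem dissipative_of_mem_shift_iff {A : LinRel 𝕜 X} {R : ℝ → X →L[𝕜] X}
    (hA : ∀ c : ℝ, 0 < c → ∀ x z, (x, z) ∈ shift (c : 𝕜) A ↔ x = R c z)
    (hR : ∀ c : ℝ, 0 < c → ‖R c‖ ≤ 1 / c) : Dissipative A := by
  intro x y hxy c hc
  have h : (x, (c : 𝕜) • x - y) ∈ shift (c : 𝕜) A := by rwa [mem_shift, sub_sub_cancel]
  have hx := (hA c hc _ _).1 h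
  have h1 : ‖x‖ ≤ 1 / c * ‖(c : 𝕜) • x - y‖ := by
    conv_lhs => rw [hx]
    exact (R c).le_of_opNorm_le (hR c hc) _
  rw [norm_smul, RCLike.norm_ofReal, abs_of_pos hc]
  rwa [one_div, inv_mul_eq_div, le_div_iff₀ hc, mul_comm] at h1

/-- Every pseudo-resolvent on `(0, ∞)` is the resolvent of a relation. -/
theorem exists_linRel_of_pseudoResolvent {R : ℝ → X →L[𝕜] X}
    (hR : ∀ b c : ℝ, 0 < b → 0 < c → R b - R c = ((c - b : ℝ) : 𝕜) • (R b * R c)) :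
    ∃ A : LinRel 𝕜 X, ∀ c : ℝ, 0 < c → ∀ x z, (x, z) ∈ shift (c : 𝕜) A ↔ x = R c z := by
  -- The kernel of `f` is the relation for which `1 - A` is the inverse of the graph of `R 1`.
  let f : X × X →ₗ[𝕜] X := LinearMap.fst 𝕜 X X -
    (R 1 : X →ₗ[𝕜] X) ∘ₗ (LinearMap.fst 𝕜 X X - LinearMap.snd 𝕜 X X)
  have hf : ∀ x y, (x, y) ∈ LinearMap.ker f ↔ x = R 1 (x - y) := by
    intro x y
    rw [LinearMap.mem_ker, ← sub_eq_zero (a := x)]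
    rfl
  refine ⟨LinearMap.ker f, fun c hc x z => ?_⟩
  have h1 : ∀ w, R 1 w - R c w = ((c - 1 : ℝ) : 𝕜) • R 1 (R c w) := fun w =>
    DFunLike.congr_fun (hR 1 c one_pos hc) w
  have h2 : ∀ w, R c w - R 1 w = ((1 - c : ℝ) : 𝕜) • R c (R 1 w) := fun w =>
    DFunLike.congr_fun (hR c 1 hc one_pos) w
  rw [mem_shift, hf]
  simp only [RCLike.ofReal_sub, RCLike.ofReal_one] at h1 h2 ⊢
  simp only [map_sub, map_smul]
  constructor
  · intro h
    have h3 := congrArg (R c) h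
    simp only [map_sub, map_smul] at h3
    -- Applying `R c` to `x = R 1 ((1 - c) x + z)` and using the resolvent identity removes `x` from
    -- the right side; substituting back gives `x = R c z`.
    have h4 : R 1 x = R c (R 1 z) := by
      linear_combination (norm := module) h3 - h2 x
    rw [h4] at h
    linear_combination (norm := module) h - h2 z
  · rintro rfl
    linear_combination (norm := module) -(1 : 𝕜) • h1 z

end Resolvent

/-! ### Integrated semigroups of operators -/

section Main

variable {𝕜 X : Type*} [RCLike 𝕜] [NormedAddCommGroup X] [NormedSpace 𝕜 X]
  [NormedSpace ℝ X] [IsScalarTower ℝ 𝕜 X]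

variable (𝕜 X) in
/-- The bounded `𝕜`-linear operators as a real normed algebra. -/
abbrev realNormedAlgebra : NormedAlgebra ℝ (X →L[𝕜] X) :=
  { Algebra.ofModule (R := ℝ) (A := X →L[𝕜] X) (fun _ _ _ => rfl)
      (fun r f g => by ext x; exact (f.restrictScalars ℝ).map_smul r (g x)) with
    norm_smul_le := fun r f => norm_smul_le r f }

theorem ofReal_smul_eq (r : ℝ) (f : X →L[𝕜] X) : (r : 𝕜) • f = r • f := by
  ext x
  exact (RCLike.real_smul_eq_coe_smul r (f x)).symm

theorem norm_smul_le_one_iff {c : ℝ} (hc : 0 < c) {f : X →L[𝕜] X} :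
    ‖c • f‖ ≤ 1 ↔ ‖f‖ ≤ 1 / c := by
  rw [norm_smul, Real.norm_of_nonneg hc.le, le_div_iff₀ hc, mul_comm]

theorem MDissipative.exists_generates [CompleteSpace X] {A : LinRel 𝕜 X} (hA : MDissipative A) :
    ∃ S : ℝ≥0 → X →L[𝕜] X,
      GeneratesIntegratedSemigroup A S ∧ IntegratedFunctionalEquation S := by
  let := realNormedAlgebra 𝕜 X
  have hQ : ∀ c : ℝ, ∃ Q : X →L[𝕜] X, 0 < c →
      (∀ x z, (x, z) ∈ shift (c : 𝕜) A ↔ x = Q z) ∧ ‖Q‖ ≤ 1 / c := by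
    intro c
    by_cases hc : 0 < c
    · obtain ⟨Q, hQ⟩ := hA.1.exists_resolvent hc (hA.ran_shift_eq_univ hc)
      exact ⟨Q, fun _ => hQ⟩
    · exact ⟨0, fun h => absurd h hc⟩
  choose R hR using hQ
  obtain ⟨S, h0, hS, hl, hd⟩ := exists_integratedSemigroup (R := R)
    ContinuousLinearMap.norm_id_le
    (fun b c hb hc => by
      have := sub_eq_smul_mul_of_mem_shift_iff (hR b hb).1 (hR c hc).1
      rwa [← RCLike.ofReal_sub, ofReal_smul_eq] at this)
    (fun c hc => (norm_smul_le_one_iff hc).2 (hR c hc).2)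
  refine ⟨S, ⟨h0, hS, fun c hc => ?_⟩, fun t s => hd t s⟩
  have h := mem_resolventSet_and_resolvent_eq (hR c hc).1
  exact ⟨h.1, integrableOn_exp_smul (continuous_comp_toNNReal hS) (norm_comp_toNNReal_le h0 hS) hc,
    h.2.trans (hl c hc)⟩

theorem GeneratesIntegratedSemigroup.unique [CompleteSpace X] {A : LinRel 𝕜 X}
    {S T : ℝ≥0 → X →L[𝕜] X} (hS : GeneratesIntegratedSemigroup A S)
    (hT : GeneratesIntegratedSemigroup A T) : S = T := by
  refine eq_of_laplace_eq hS.1 hT.1 hS.2.1 hT.2.1 fun c hc => ?_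
  have h := (hS.2.2 c hc).2.2.symm.trans (hT.2.2 c hc).2.2
  exact smul_right_injective _ hc.ne' h

theorem ResolventIsLaplace.unique [CompleteSpace X] {A B : LinRel 𝕜 X} {S : ℝ≥0 → X →L[𝕜] X}
    (hA : ResolventIsLaplace A S) (hB : ResolventIsLaplace B S) : A = B := by
  obtain ⟨hA1, -, hA2⟩ := hA 1 one_pos
  obtain ⟨hB1, -, hB2⟩ := hB 1 one_pos
  refine shift_injective (c := ((1 : ℝ) : 𝕜)) ?_
  ext ⟨x, z⟩
  rw [mem_shift_iff_eq_resolvent hA1, mem_shift_iff_eq_resolvent hB1, hA2, hB2]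

theorem exists_mDissipative_of_functionalEquation [CompleteSpace X] {S : ℝ≥0 → X →L[𝕜] X}
    (h0 : S 0 = 0) (hS : ∀ t s : ℝ≥0, ‖S t - S s‖ ≤ |(t : ℝ) - (s : ℝ)|)
    (hd : IntegratedFunctionalEquation S) :
    ∃ A : LinRel 𝕜 X, MDissipative A ∧ ResolventIsLaplace A S := by
  let := realNormedAlgebra 𝕜 X
  set R : ℝ → X →L[𝕜] X :=
    fun c => c • ∫ t in Ioi (0 : ℝ), Real.exp (-c * t) • S t.toNNReal with hR
  have hRb : ∀ c : ℝ, 0 < c → ‖R c‖ ≤ 1 / c := fun c hc =>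
    (norm_smul_le_one_iff hc).1 (norm_smul_laplace_le h0 hS hc)
  obtain ⟨A, hA⟩ := exists_linRel_of_pseudoResolvent (R := R) fun b c hb hc => by
    rw [ofReal_smul_eq]
    exact resolvent_identity_of_functionalEquation h0 hS (fun t s => hd t s)
      (fun c _ => rfl) hb hc
  refine ⟨A, ⟨dissipative_of_mem_shift_iff hA hRb, 1, one_pos, ?_⟩, fun c hc => ?_⟩
  · exact eq_univ_of_forall fun z => ⟨R 1 z, (hA 1 one_pos _ _).2 rfl⟩
  · have h := mem_resolventSet_and_resolvent_eq (hA c hc)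
    exact ⟨h.1,
      integrableOn_exp_smul (continuous_comp_toNNReal hS) (norm_comp_toNNReal_le h0 hS) hc, h.2⟩

end Main

end LinRel

theorem mainTheorem7 {𝕜 X : Type*} [RCLike 𝕜] [NormedAddCommGroup X] [NormedSpace 𝕜 X]
    [NormedSpace ℝ X] [IsScalarTower ℝ 𝕜 X] [CompleteSpace X] :
    (∀ A : LinRel 𝕜 X, LinRel.MDissipative A →
      (∃! S : ℝ≥0 → X →L[𝕜] X, LinRel.GeneratesIntegratedSemigroup A S) ∧
      (∀ S : ℝ≥0 → X →L[𝕜] X, LinRel.GeneratesIntegratedSemigroup A S →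
        LinRel.IntegratedFunctionalEquation S)) ∧
    (∀ S : ℝ≥0 → X →L[𝕜] X,
      S 0 = 0 →
      (∀ t s : ℝ≥0, ‖S t - S s‖ ≤ |(t : ℝ) - (s : ℝ)|) →
      LinRel.IntegratedFunctionalEquation S →
      ∃! A : LinRel 𝕜 X, LinRel.MDissipative A ∧ LinRel.ResolventIsLaplace A S) := by
  refine ⟨fun A hA => ?_, fun S h0 hS hd => ?_⟩
  · obtain ⟨S, hS, hd⟩ := hA.exists_generates
    -- The functional equation is known for the constructed `S`; uniqueness transfers it to every
    -- generated `T`.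
    exact ⟨⟨S, hS, fun T hT => hT.unique hS⟩, fun T hT => hT.unique hS ▸ hd⟩
  · obtain ⟨A, hA, hl⟩ := LinRel.exists_mDissipative_of_functionalEquation h0 hS hd
    exact ⟨A, ⟨hA, hl⟩, fun B hB => hB.2.unique hl⟩
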